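/- Let $p$ be a prime, $f\ge 1$, $q=p^f$, and let $r=(r_0,\dots,r_{f-1})$ be a tuple of integers with $r_i\ge 2q+1$ for all $i$. Let $V_r=\bigotimes_{i=0}^{f-1}(\mathrm{Sym}^{r_i}\mathbb F_q^2\circ \mathrm{Fr}^i)$, modeled on the polynomials in $\mathbb F_q[x_0,y_0,\dots,x_{f-1},y_{f-1}]$ that are homogeneous of degree $r_i$ in $x_i,y_i$ for each $i$, where $\begin{pmatrix}a&b\\c&d\end{pmatrix}\in \mathrm{GL}_2(\mathbb F_q)$ acts by $x_i\mapsto a^{p^i}x_i+c^{p^i}y_i$, $y_i\mapsto b^{p^i}x_i+d^{p^i}y_i$. Put $\theta_i=x_iy_{i-1}^p-y_ix_{i-1}^p$ (indices modulo $f$). For polynomials $P_1,\dots,P_t$ let $\langle P_1,\dots,P_t\rangle=\langle P_1\rangle+\dots+\langle P_t\rangle$, where $\langle P\rangle\subset V_r$ is the subspace of elements divisible by $P$; let $V_r^{**}=\langle\theta_0^2,\dots,\theta_{f-1}^2\rangle$, and for a subrepresentation $V\subset V_r$ let $[V]=(V+V_r^{**})/V_r^{**}$. For $X\subseteq\{0,\dots,f-1\}$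 let $P_X=\prod_{i\in X}\theta_i$, and say that $Y$ covers $X$ if $X\subset Y$ and $|Y|=|X|+1$. Define the subquotient of $V_r/V_r^{**}$ $$V_X=\frac{[\langle P_X\rangle]}{[\langle P_Z : Z\text{ covers }X\rangle]},$$ and, for $X\subseteq Y$, the subquotient $$E_{X,Y}=\frac{[\langle P_X\rangle]}{[\langle P_Z,\ P_{Y'} : Z\text{ covers }X,\ Z\ne Y,\ Y'\text{ covers }Y\rangle]}.$$ Here a subquotient is a pair of nested subrepresentations, and two subquotients are equal if the pairs are equal. Then: 1. Every $V_X$ is a principal series, i.e. isomorphic to $\mathrm{ind}_{B(\mathbb F_q)}^{\mathrm{GL}_2(\mathbb F_q)}\chi$ for a character $\chi:B(\mathbb F_q)\to\mathbb F_q^\times$ of the upper triangular subgroup. 2. If $Y$ covers $X$, the maps induced by the inclusions form a short exact sequence of representations $0\to V_Y\to E_{X,Y}\to V_X\to 0$. 3. Let $G$ be the directed graph whose vertices are the subquotients of the form $V_X$, with an edge from $u$ to $v$ if and only if there are $X\subseteq Y$ with $u=V_X$, $v=V_Y$ such that the maps induced by the inclusions are defined and form a short exact sequence $0\to V_Y\to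 E_{X,Y}\to V_X\to 0$. Then $X\mapsto V_X$ is an isomorphism onto $G$ from the directed hypercube graph $\bar Q_f$, whose vertices are the subsets of $\{0,\dots,f-1\}$, with an edge from $X$ to $Y$ if and only if $Y$ covers $X$. In particular $G$ has $2^f$ vertices. -/

import Mathlib

open MvPolynomial Matrix

section Subquotients

variable {k G W : Type*} [Field k] [Group G] [AddCommGroup W] [Module k W]

/-- The representation on the quotient of a representation by a subrepresentation. -/
def Subrepresentation.quotRep {ρ : Representation k G W} (N : Subrepresentation ρ) :
    Representation k G (W ⧸ N.toSubmodule) :=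
  ρ.quotient N.toSubmodule fun g _ hv => N.apply_mem_toSubmodule g hv

/-- For a subrepresentation `V` of `W`, the subrepresentation `[V] = (V + N) / N` of `W / N`,
that is, the image of `V` in `W / N`. -/
def Subrepresentation.bracket {ρ : Representation k G W} (N V : Subrepresentation ρ) :
    Subrepresentation N.quotRep where
  toSubmodule := V.toSubmodule.map N.toSubmodule.mkQ
  apply_mem_toSubmodule g := by
    rintro _ ⟨v, hv, rfl⟩
    exact ⟨ρ g v, V.apply_mem_toSubmodule g hv, rfl⟩

theorem Subrepresentation.bracket_mono {ρ : Representation k G W} (N : Subrepresentation ρ)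
    {V V' : Subrepresentation ρ} (h : V ≤ V') : N.bracket V ≤ N.bracket V' :=
  Submodule.map_mono (f := N.toSubmodule.mkQ) (show V.toSubmodule ≤ V'.toSubmodule from h)

/-- A subquotient `top / bot` of a representation, given by two subrepresentations
`bot ≤ top`. -/
@[ext]
structure Subquotient (ρ : Representation k G W) where
  top : Subrepresentation ρ
  bot : Subrepresentation ρ
  bot_le_top : bot ≤ top

namespace Subquotient

variable {ρ : Representation k G W}

/-- `bot`, viewed as a subrepresentation of `top`. -/
def inner (S : Subquotient ρ) : Subrepresentation S.top.toRepresentation where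
  toSubmodule := S.bot.toSubmodule.submoduleOf S.top.toSubmodule
  apply_mem_toSubmodule g _ hv := S.bot.apply_mem_toSubmodule g hv

/-- The vector space `top / bot`. -/
abbrev Carrier (S : Subquotient ρ) : Type _ := S.top.toSubmodule ⧸ S.inner.toSubmodule

/-- The representation on `top / bot`. -/
def rep (S : Subquotient ρ) : Representation k G S.Carrier := S.inner.quotRep

/-- The equivariant map `S.top / S.bot → T.top / T.bot` induced by the inclusions
`S.top ≤ T.top` and `S.bot ≤ T.bot`. -/
def natMap (S T : Subquotient ρ) (ht : S.top ≤ T.top) (hb : S.bot ≤ T.bot) :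
    S.rep.IntertwiningMap T.rep where
  toLinearMap := Submodule.mapQ S.inner.toSubmodule T.inner.toSubmodule
    (Submodule.inclusion (show S.top.toSubmodule ≤ T.top.toSubmodule from ht))
    (fun _ hv => hb hv)
  isIntertwining' g := by
    refine LinearMap.ext fun v => ?_
    induction v using Submodule.Quotient.induction_on with
    | _ v => rfl

/-- `E` is an extension of `U` by `V` through the maps induced by inclusions: these maps are
defined, and `0 → V → E → U → 0` is a short exact sequence (of representations). -/
def IsNaturalExtension (V E U : Subquotient ρ) : Prop :=
  ∃ (ht₁ : V.top ≤ E.top) (hb₁ : V.bot ≤ E.bot) (ht₂ : E.top ≤ U.top) (hb₂ : E.bot ≤ U.bot),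
    Function.Injective (V.natMap E ht₁ hb₁) ∧
    Function.Exact (V.natMap E ht₁ hb₁) (E.natMap U ht₂ hb₂) ∧
    Function.Surjective (E.natMap U ht₂ hb₂)

end Subquotient

end Subquotients

section PrincipalSeries

variable (k : Type*) [Field k]

/-- The subgroup of upper triangular matrices in `GL₂(k)`. -/
def borelSubgroup : Subgroup (GL (Fin 2) k) where
  carrier := {g | g 1 0 = 0}
  one_mem' := by simp
  mul_mem' {a b} ha hb := by
    simp only [Set.mem_ofPred_eq] at ha hb ⊢
    simp [Matrix.mul_apply, Fin.sum_univ_two, ha, hb]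
  inv_mem' {a} ha := by
    simp only [Set.mem_ofPred_eq] at ha ⊢
    simp [Matrix.inv_def, Matrix.adjugate_fin_two, ha]

variable {k}

/-- The one-dimensional representation on `k` attached to a character with values in `kˣ`. -/
def charRep {B : Type*} [Group B] (χ : B →* kˣ) : Representation k B k :=
  ((Algebra.lmul k k : k →* Module.End k k)).comp ((Units.coeHom k).comp χ)

/-- A principal series: a representation isomorphic to the induction of a character `χ` of the
Borel subgroup, i.e. to the space of functions `φ : GL₂(k) → k` with `φ (b g) = χ b * φ g`,
on which `GL₂(k)` acts by right translation. -/
def IsPrincipalSeries {W : Type*} [AddCommGroup W] [Module k W]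
    (σ : Representation k (GL (Fin 2) k) W) : Prop :=
  ∃ χ : borelSubgroup k →* kˣ,
    Nonempty (σ.Equiv (Representation.coind (borelSubgroup k).subtype (charRep χ)))

end PrincipalSeries

section Hypercube

/-- The elements `Y` of the power set with `X ⊂ Y` and `|Y| = |X| + 1`. -/
def covers {f : ℕ} (X : Finset (Fin f)) : Finset (Finset (Fin f)) :=
  Finset.univ.filter fun Y => X ⊂ Y ∧ Y.card = X.card + 1

theorem subset_of_mem_covers {f : ℕ} {X Y : Finset (Fin f)} (h : Y ∈ covers X) : X ⊆ Y :=
  (Finset.mem_filter.mp h).2.1.subset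

/-- The directed hypercube graph on the power set of an `n`-element set. -/
def directedHypercube (n : ℕ) : Digraph (Finset (Fin n)) where
  Adj X Y := X ⊂ Y ∧ Y.card = X.card + 1

end Hypercube

noncomputable section ThetaFiltration

variable (p f : ℕ) [Fact p.Prime]

/-- The field with `p ^ f` elements. -/
abbrev Fq : Type := GaloisField p f

/-- The polynomial ring `𝔽_q[x_0, y_0, ..., x_{f-1}, y_{f-1}]`; the variable `(i, 0)` is `x_i`
and the variable `(i, 1)` is `y_i`. -/
abbrev PolyRing : Type := MvPolynomial (Fin f × Fin 2) (Fq p f)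

/-- The matrix `g` acts by the substitution `x_i ↦ a^(p^i) x_i + c^(p^i) y_i`,
`y_i ↦ b^(p^i) x_i + d^(p^i) y_i`, where `g = (a, b; c, d)`. -/
def subst (g : GL (Fin 2) (Fq p f)) : PolyRing p f →ₐ[Fq p f] PolyRing p f :=
  aeval fun v => ∑ l : Fin 2, C (g l v.2 ^ p ^ (v.1 : ℕ)) * X (v.1, l)

theorem subst_one : subst p f 1 = AlgHom.id _ _ := by
  refine MvPolynomial.algHom_ext fun ⟨i, j⟩ => ?_
  fin_cases j <;>
    simp [subst, Fin.sum_univ_two, (Fact.out : p.Prime).ne_zero]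

theorem subst_mul (g h : GL (Fin 2) (Fq p f)) :
    subst p f (g * h) = (subst p f g).comp (subst p f h) := by
  refine MvPolynomial.algHom_ext fun ⟨i, j⟩ => ?_
  have e : ∀ c, subst p f g (C c) = C c := fun c => (subst p f g).commutes c
  simp only [AlgHom.comp_apply]
  simp only [subst, aeval_X, Fin.sum_univ_two, map_add, map_mul, Units.val_mul,
    Matrix.mul_apply, add_pow_char_pow, mul_pow]
  simp only [← MvPolynomial.algebraMap_eq, AlgHom.commutes]
  ring

/-- The action of `GL₂(𝔽_q)` on the polynomial ring. -/
def polyRep : Representation (Fq p f) (GL (Fin 2) (Fq p f)) (PolyRing p f) where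
  toFun g := (subst p f g).toLinearMap
  map_one' := by rw [subst_one]; rfl
  map_mul' g h := by rw [subst_mul]; rfl

theorem polyRep_apply (g : GL (Fin 2) (Fq p f)) (P : PolyRing p f) :
    polyRep p f g P = subst p f g P := rfl

/-- The weight of a variable: `x_i` and `y_i` have multidegree `e_i`. -/
def varWeight (v : Fin f × Fin 2) : Fin f → ℕ := Pi.single v.1 1

/-- `V_r`: the polynomials which are homogeneous of degree `r_i` in `x_i, y_i` for every `i`,
as a subrepresentation of the polynomial ring. This is the model of
`⨂_i (Sym^{r_i} 𝔽_q² ∘ Fr^i)`. -/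
def symPow (r : Fin f → ℕ) : Subrepresentation (polyRep p f) where
  toSubmodule := weightedHomogeneousSubmodule (Fq p f) (varWeight f) r
  apply_mem_toSubmodule g P hP := by
    rw [mem_weightedHomogeneousSubmodule] at hP ⊢
    rw [polyRep_apply, P.as_sum, map_sum]
    refine (weightedHomogeneousSubmodule (Fq p f) (varWeight f) r).sum_mem fun d hd => ?_
    rw [mem_weightedHomogeneousSubmodule]
    have hw := hP (mem_support_iff.mp hd)
    rw [subst, aeval_monomial, MvPolynomial.algebraMap_eq]
    have h1 : ∀ v : Fin f × Fin 2, IsWeightedHomogeneous (varWeight f)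
        (∑ l : Fin 2, (C (g l v.2 ^ p ^ (v.1 : ℕ)) * X (v.1, l) : PolyRing p f))
        (varWeight f v) := fun v => by
      rw [← mem_weightedHomogeneousSubmodule]
      refine Submodule.sum_mem _ fun l _ => ?_
      rw [mem_weightedHomogeneousSubmodule]
      have := (isWeightedHomogeneous_C (R := Fq p f) (varWeight f)
        (g l v.2 ^ p ^ (v.1 : ℕ))).mul
        (isWeightedHomogeneous_X (Fq p f) (varWeight f) (v.1, l))
      rwa [zero_add] at this
    have h2 := IsWeightedHomogeneous.prod d.support
      (fun v => (∑ l : Fin 2, (C (g l v.2 ^ p ^ (v.1 : ℕ)) * X (v.1, l) : PolyRing p f)) ^ d v)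
      (fun v => d v • varWeight f v) (fun v _ => (h1 v).pow _)
    have h3 := (isWeightedHomogeneous_C (R := Fq p f) (varWeight f) (coeff d P)).mul h2
    rw [zero_add] at h3
    rw [← hw]
    exact h3

/-- `V_r` as a representation of `GL₂(𝔽_q)`. -/
abbrev symRep (r : Fin f → ℕ) :
    Representation (Fq p f) (GL (Fin 2) (Fq p f)) (symPow p f r).toSubmodule :=
  (symPow p f r).toRepresentation

/-- `P` divides all its translates under `GL₂(𝔽_q)`. -/
def DvdStable (P : PolyRing p f) : Prop := ∀ g, P ∣ subst p f g P

/-- `⟨P⟩`: the polynomials in `V_r` that are divisible by `P`. -/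
def multiples (r : Fin f → ℕ) (P : PolyRing p f) (hP : DvdStable p f P) :
    Subrepresentation (symRep p f r) where
  toSubmodule :=
    { carrier := {v | P ∣ (v : PolyRing p f)}
      add_mem' := fun ha hb => dvd_add ha hb
      zero_mem' := dvd_zero P
      smul_mem' := fun c v hv => by
        change P ∣ c • (v : PolyRing p f)
        rw [MvPolynomial.smul_eq_C_mul]
        exact Dvd.dvd.mul_left hv _ }
  apply_mem_toSubmodule g v hv := by
    change P ∣ subst p f g (v : PolyRing p f)
    exact (hP g).trans (map_dvd (subst p f g) hv)

variable [NeZero f]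

/-- `θ_i = x_i y_{i-1}^p - y_i x_{i-1}^p`, the index `i - 1` being taken modulo `f`. -/
def theta (i : Fin f) : PolyRing p f :=
  X (i, 0) * X (i - 1, 1) ^ p - X (i, 1) * X (i - 1, 0) ^ p

/-- `P_X = ∏_{i ∈ X} θ_i`. -/
def thetaProd (X : Finset (Fin f)) : PolyRing p f := ∏ i ∈ X, theta p f i

theorem frob_step (i : Fin f) (a : Fq p f) :
    (a ^ p ^ ((i - 1 : Fin f) : ℕ)) ^ p = a ^ p ^ (i : ℕ) := by
  have hf : f ≠ 0 := NeZero.ne f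
  rw [← pow_mul, ← pow_succ]
  by_cases hi : i = 0
  · subst hi
    have hv : ((0 - 1 : Fin f) : ℕ) + 1 = f := by
      rcases f with _ | _ | n
      · exact absurd rfl hf
      · rfl
      · simp
    rw [hv]
    have : Fintype (Fq p f) := Fintype.ofFinite _
    have hc : Fintype.card (Fq p f) = p ^ f := by
      rw [← Nat.card_eq_fintype_card, GaloisField.card p f hf]
    rw [← hc, FiniteField.pow_card]
    simp
  · have hv : ((i - 1 : Fin f) : ℕ) + 1 = i := by
      have h0 : (i : ℕ) ≠ 0 := fun h => hi (Fin.ext (by simpa using h))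
      have hlt := i.isLt
      rcases f with _ | _ | n
      · exact absurd rfl hf
      · omega
      · rw [Fin.val_sub_one_of_ne_zero hi]
        omega
    rw [hv]

theorem subst_theta (g : GL (Fin 2) (Fq p f)) (i : Fin f) :
    subst p f g (theta p f i) =
      C ((g 0 0 * g 1 1 - g 0 1 * g 1 0) ^ p ^ (i : ℕ)) * theta p f i := by
  have key : ∀ (a b : Fq p f) (j l : Fin 2),
      ((C a ^ p ^ ((i - 1 : Fin f) : ℕ) * X (i - 1, j) +
        C b ^ p ^ ((i - 1 : Fin f) : ℕ) * X (i - 1, l) : PolyRing p f)) ^ p =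
      C a ^ p ^ (i : ℕ) * X (i - 1, j) ^ p + C b ^ p ^ (i : ℕ) * X (i - 1, l) ^ p := by
    intro a b j l
    rw [add_pow_char, mul_pow, mul_pow, ← C_pow, ← C_pow, ← C_pow, ← C_pow, frob_step, frob_step]
    simp only [C_pow]
  simp only [theta, map_sub, map_mul, map_pow, subst, aeval_X, Fin.sum_univ_two]
  rw [key, key, sub_pow_char_pow, mul_pow, mul_pow]
  ring

theorem dvdStable_theta_pow (i : Fin f) (n : ℕ) : DvdStable p f (theta p f i ^ n) := by
  intro g
  rw [map_pow, subst_theta]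
  exact pow_dvd_pow_of_dvd (Dvd.intro_left _ rfl) n

theorem dvdStable_thetaProd (X : Finset (Fin f)) : DvdStable p f (thetaProd p f X) := by
  intro g
  rw [thetaProd, map_prod]
  refine Finset.prod_dvd_prod_of_dvd _ _ fun i _ => ?_
  rw [subst_theta]
  exact Dvd.intro_left _ rfl

variable (r : Fin f → ℕ)

/-- `V_r^{(n)} = ⟨θ_0^n, ..., θ_{f-1}^n⟩ = ⟨θ_0^n⟩ + ... + ⟨θ_{f-1}^n⟩`. -/
def symPowTheta (n : ℕ) : Subrepresentation (symRep p f r) :=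
  Finset.univ.sup fun i => multiples p f r (theta p f i ^ n) (dvdStable_theta_pow p f i n)

/-- The subrepresentation `V_r^{**} = V_r^{(2)}`. -/
abbrev symPowStarStar : Subrepresentation (symRep p f r) := symPowTheta p f r 2

/-- The representation `V_r / V_r^{**}`. -/
abbrev quotStarStar := (symPowStarStar p f r).quotRep

/-- The subrepresentation `⟨P_X⟩` of `V_r`. -/
abbrev thetaMultiples (X : Finset (Fin f)) : Subrepresentation (symRep p f r) :=
  multiples p f r (thetaProd p f X) (dvdStable_thetaProd p f X)

/-- For a finite family `S` of subsets, `⟨P_Z : Z ∈ S⟩ = ∑_{Z ∈ S} ⟨P_Z⟩`. -/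
def thetaSpan (S : Finset (Finset (Fin f))) : Subrepresentation (symRep p f r) :=
  S.sup (thetaMultiples p f r)

theorem thetaSpan_le {X : Finset (Fin f)} {S : Finset (Finset (Fin f))}
    (h : ∀ Z ∈ S, X ⊆ Z) : thetaSpan p f r S ≤ thetaMultiples p f r X :=
  Finset.sup_le fun Z hZ _ hv =>
    (Finset.prod_dvd_prod_of_subset X Z (theta p f) (h Z hZ)).trans hv

/-- The subquotient `V_X = [⟨P_X⟩] / [⟨P_Z : X ⊂ Z, |Z| = |X| + 1⟩]` of `V_r / V_r^{**}`. -/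
def vertexRep (X : Finset (Fin f)) : Subquotient (quotStarStar p f r) where
  top := (symPowStarStar p f r).bracket (thetaMultiples p f r X)
  bot := (symPowStarStar p f r).bracket (thetaSpan p f r (covers X))
  bot_le_top := Subrepresentation.bracket_mono _
    (thetaSpan_le p f r fun _ hZ => subset_of_mem_covers hZ)

/-- The subquotient `E_{X,Y}` of `V_r / V_r^{**}`: the quotient of `[⟨P_X⟩]` by the brackets of
the `P_Z` with `X ⊂ Z`, `|Z| = |X| + 1`, `Z ≠ Y` and of the `P_{Y'}` with `Y ⊂ Y'`,
`|Y'| = |Y| + 1`. -/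
def extRep (X Y : Finset (Fin f)) (h : X ⊆ Y) : Subquotient (quotStarStar p f r) where
  top := (symPowStarStar p f r).bracket (thetaMultiples p f r X)
  bot := (symPowStarStar p f r).bracket (thetaSpan p f r ((covers X).erase Y ∪ covers Y))
  bot_le_top := Subrepresentation.bracket_mono _ (thetaSpan_le p f r fun Z hZ => by
    rcases Finset.mem_union.mp hZ with hZ | hZ
    · exact subset_of_mem_covers (Finset.mem_of_mem_erase hZ)
    · exact h.trans (subset_of_mem_covers hZ))

/-- The directed graph whose vertices are the subquotients of `V_r / V_r^{**}` of the form `V_X`,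
with an edge from `u` to `v` when `u = V_X` and `v = V_Y` for some `X ⊆ Y` such that `E_{X,Y}` is
an extension of `V_X` by `V_Y` through the natural maps. -/
def extensionGraph : Digraph (Set.range (vertexRep p f r)) where
  Adj u v := ∃ (X Y : Finset (Fin f)) (h : X ⊆ Y),
    u.1 = vertexRep p f r X ∧ v.1 = vertexRep p f r Y ∧
    (vertexRep p f r Y).IsNaturalExtension (extRep p f r X Y h) (vertexRep p f r X)

end ThetaFiltration

/-! For each $X$ one equivariant map separates $V_X$ from everything around it. Put
$x_i=\varepsilon_i$, $y_i=1$ and work modulo the $\varepsilon_i^2$. Since $p\ge 2$,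
$\theta_i=\varepsilon_i-\varepsilon_{i-1}^p$ becomes $\varepsilon_i$. The coefficient of
$\prod_{i\in X}\varepsilon_i$ therefore kills $V_r^{**}$, kills $\langle P_Z\rangle$ unless
$Z\subseteq X$, and sends $P_Xu$ to $u(0,1)$. Taking this coefficient on all translates gives
`thetaMap`, from $V_r$ to functions on $\mathrm{GL}_2(\mathbb F_q)$. On $\langle P_X\rangle$ it is
$P_Xu\mapsto(g\mapsto\det(g)^n\,u(\text{bottom row of }g))$ with $n=\sum_{i\in X}p^i$, so it lands
in an induction from the Borel subgroup.

The image and kernel come from normal forms: modulo multiples of the $\theta_i$, a polynomial of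
multidegree $s$ with all $s_i\ge p$ reduces to $q+1$ monomials, which evaluation at the $q+1$ points
of $\mathbb P^1(\mathbb F_q)$ separates. So every value at these points occurs, and $u$ vanishes at
all of them only if it is a sum of multiples of the $\theta_i$ (`mem_thetaPart_of_pointEval`). Then
$P_Xu$ is a sum of multiples of the $\theta_iP_X$, each in $V_r^{**}$ or in $\langle P_Z\rangle$
with $Z$ covering $X$ (`thetaProd_mul_mem`). Hence $V_X$ is the whole induction.

The extensions and the graph follow from this kernel computation, the vanishing of `thetaMap` on
$\langle P_Z\rangle$ for $Z\not\subseteq X$, and $V_X\ne0$. -/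

/-! ### Normal forms modulo the $\theta_i$ and evaluation on $\mathbb P^1(\mathbb F_q)$ -/

noncomputable section NormalForms

variable (p f : ℕ) [Fact p.Prime]

/-- Evaluation at the point `x_i = z_0^(p^i)`, `y_i = z_1^(p^i)`. -/
def pointEval (z : Fin 2 → Fq p f) : PolyRing p f →ₐ[Fq p f] Fq p f :=
  aeval fun v => z v.2 ^ p ^ (v.1 : ℕ)

theorem pointEval_subst (z : Fin 2 → Fq p f) (g : GL (Fin 2) (Fq p f)) (P : PolyRing p f) :
    pointEval p f z (subst p f g P) = pointEval p f (z ᵥ* g.1) P := by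
  have : (pointEval p f z).comp (subst p f g) = pointEval p f (z ᵥ* g.1) := by
    refine MvPolynomial.algHom_ext fun ⟨i, j⟩ => ?_
    simp only [AlgHom.comp_apply, subst, pointEval, aeval_X, Fin.sum_univ_two, map_add, map_mul,
      ← MvPolynomial.algebraMap_eq, AlgHom.commutes, Matrix.vecMul, dotProduct,
      add_pow_char_pow, mul_pow]
    simp only [Algebra.algebraMap_self, RingHom.id_apply]
    ring
  exact DFunLike.congr_fun this P

variable {f} in
/-- The exponent of the monomial `∏ x_i^(a_i) y_i^(s_i - a_i)`. -/
def bihomExponent (s a : Fin f → ℕ) : Fin f × Fin 2 →₀ ℕ :=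
  Finsupp.equivFunOnFinite.symm fun v => if v.2 = 0 then a v.1 else s v.1 - a v.1

theorem weight_varWeight (e : Fin f × Fin 2 →₀ ℕ) (i : Fin f) :
    Finsupp.weight (varWeight f) e i = e (i, 0) + e (i, 1) := by
  rw [Finsupp.weight_apply, Finsupp.sum_fintype _ _ (by simp), Finset.sum_apply,
    Fintype.sum_prod_type]
  simp [varWeight, Pi.single_apply]

variable {f}

theorem eq_bihomExponent {s : Fin f → ℕ} {e : Fin f × Fin 2 →₀ ℕ}
    (he : Finsupp.weight (varWeight f) e = s) : e = bihomExponent s fun i => e (i, 0) := by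
  ext ⟨i, j⟩
  have := weight_varWeight f e i
  rw [he] at this
  fin_cases j <;> simp [bihomExponent, this]

theorem weight_bihomExponent {s a : Fin f → ℕ} (h : ∀ i, a i ≤ s i) :
    Finsupp.weight (varWeight f) (bihomExponent s a) = s := by
  ext i
  rw [weight_varWeight]
  simp [bihomExponent, h i]

/-- The monomial `∏ x_i^(a_i) y_i^(s_i - a_i)`. -/
def bihomMonomial (s a : Fin f → ℕ) : PolyRing p f := monomial (bihomExponent s a) 1

theorem bihomMonomial_mem {s a : Fin f → ℕ} (h : ∀ i, a i ≤ s i) :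
    bihomMonomial p s a ∈ (symPow p f s).toSubmodule :=
  isWeightedHomogeneous_monomial _ _ _ (weight_bihomExponent h)

theorem pointEval_bihomMonomial (s a : Fin f → ℕ) (z : Fin 2 → Fq p f) :
    pointEval p f z (bihomMonomial p s a) =
      (∏ i : Fin f, (z 0 ^ p ^ (i : ℕ)) ^ a i) * ∏ i : Fin f, (z 1 ^ p ^ (i : ℕ)) ^ (s i - a i) := by
  rw [pointEval, bihomMonomial, aeval_monomial, Finsupp.prod_fintype _ _ (by simp),
    Fintype.prod_prod_type]
  simp [bihomExponent, Finset.prod_mul_distrib]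

theorem pointEval_bihomMonomial_one (s a : Fin f → ℕ) (t : Fq p f) :
    pointEval p f ![t, 1] (bihomMonomial p s a) = t ^ ∑ i : Fin f, a i * p ^ (i : ℕ) := by
  rw [pointEval_bihomMonomial, ← Finset.prod_pow_eq_pow_sum]
  simp [← pow_mul, mul_comm]

theorem pointEval_bihomMonomial_infty {s a : Fin f → ℕ} {i : Fin f} (h : a i < s i) :
    pointEval p f ![1, 0] (bihomMonomial p s a) = 0 := by
  rw [pointEval_bihomMonomial]
  refine mul_eq_zero_of_right _ (Finset.prod_eq_zero (Finset.mem_univ i) ?_)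
  have : (p ^ (i : ℕ)) ≠ 0 := pow_ne_zero _ (Fact.out : p.Prime).ne_zero
  simp [zero_pow this, zero_pow (Nat.sub_ne_zero_of_lt h)]

theorem pointEval_bihomMonomial_self_infty (s : Fin f → ℕ) :
    pointEval p f ![1, 0] (bihomMonomial p s s) = 1 := by
  rw [pointEval_bihomMonomial]
  simp

/-- The combination of the monomials `∏ x_i^(a_i) y_i^(s_i - a_i)` with `a_i < p` whose
coefficients are those of `Q`, the digits of the exponent being the `a_i`. -/
def digitPoly (s : Fin f → ℕ) : Polynomial (Fq p f) →ₗ[Fq p f] PolyRing p f :=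
  ∑ a : Fin f → Fin p,
    (Polynomial.lcoeff (Fq p f) (finFunctionFinEquiv a)).smulRight
      (bihomMonomial p s fun i => a i)

theorem digitPoly_apply (s : Fin f → ℕ) (Q : Polynomial (Fq p f)) :
    digitPoly p s Q =
      ∑ a : Fin f → Fin p, Q.coeff (finFunctionFinEquiv a) • bihomMonomial p s fun i => a i := by
  simp [digitPoly]

theorem digitPoly_mem {s : Fin f → ℕ} (hs : ∀ i, p ≤ s i) (Q : Polynomial (Fq p f)) :
    digitPoly p s Q ∈ (symPow p f s).toSubmodule := by
  rw [digitPoly_apply]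
  exact Submodule.sum_mem _ fun a _ => Submodule.smul_mem _ _ <|
    bihomMonomial_mem p fun i => (a i).isLt.le.trans (hs i)

/-- At $(t,1)$ the monomial with $x$-exponents $a_i<p$ becomes $t^{\sum a_ip^i}$. By uniqueness of
base-$p$ digits each exponent below $q$ arises exactly once. -/
theorem pointEval_digitPoly (s : Fin f → ℕ) {Q : Polynomial (Fq p f)}
    (hQ : Q ∈ Polynomial.degreeLT (Fq p f) (p ^ f)) (t : Fq p f) :
    pointEval p f ![t, 1] (digitPoly p s Q) = Q.eval t := by
  rw [digitPoly_apply, map_sum]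
  simp only [map_smul, pointEval_bihomMonomial_one, ← finFunctionFinEquiv_apply, smul_eq_mul]
  rw [Equiv.sum_comp finFunctionFinEquiv fun n : Fin (p ^ f) => Q.coeff n * t ^ (n : ℕ),
    Fin.sum_univ_eq_sum_range fun n => Q.coeff n * t ^ n]
  rw [Polynomial.mem_degreeLT] at hQ
  refine (Polynomial.eval_eq_sum_range' ?_ t).symm
  rcases eq_or_ne Q 0 with rfl | h0
  · simpa using pow_pos (Fact.out : p.Prime).pos f
  · exact (Polynomial.natDegree_lt_iff_degree_lt h0).2 hQ

theorem digitPoly_X_pow (s : Fin f → ℕ) (a : Fin f → Fin p) :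
    digitPoly p s (Polynomial.X ^ (finFunctionFinEquiv a : ℕ)) =
      bihomMonomial p s fun i => a i := by
  rw [digitPoly_apply, Finset.sum_eq_single a]
  · simp
  · intro b _ hb
    have : (finFunctionFinEquiv b : ℕ) ≠ finFunctionFinEquiv a := fun h =>
      hb (finFunctionFinEquiv.injective (Fin.ext h))
    rw [Polynomial.coeff_X_pow, if_neg this, zero_smul]
  · simp

variable [NeZero f]

theorem pointEval_digitPoly_infty {s : Fin f → ℕ} (hs : ∀ i, p ≤ s i)
    (Q : Polynomial (Fq p f)) : pointEval p f ![1, 0] (digitPoly p s Q) = 0 := by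
  rw [digitPoly_apply, map_sum]
  refine Finset.sum_eq_zero fun a _ => ?_
  rw [map_smul, pointEval_bihomMonomial_infty p (i := 0) ((a 0).isLt.trans_le (hs 0)), smul_zero]

variable (f) in
theorem pointEval_theta (z : Fin 2 → Fq p f) (i : Fin f) :
    pointEval p f z (theta p f i) = 0 := by
  simp only [theta, pointEval, map_sub, map_mul, map_pow, aeval_X, frob_step]
  ring

/-- The sum over `i` of the spaces of multiples of `θ_i` in `V_s`. -/
def thetaPart (s : Fin f → ℕ) : Submodule (Fq p f) (PolyRing p f) :=
  ⨆ i, (symPow p f s).toSubmodule ⊓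
    (Ideal.span {theta p f i}).restrictScalars (Fq p f)

theorem mem_thetaPart {s : Fin f → ℕ} {v : PolyRing p f} (i : Fin f)
    (hv : v ∈ (symPow p f s).toSubmodule) (h : theta p f i ∣ v) : v ∈ thetaPart p s :=
  (le_iSup (fun i => (symPow p f s).toSubmodule ⊓
    (Ideal.span {theta p f i}).restrictScalars (Fq p f)) i) ⟨hv, Ideal.mem_span_singleton.2 h⟩

theorem pointEval_eq_zero_of_mem_thetaPart {s : Fin f → ℕ} {v : PolyRing p f}
    (hv : v ∈ thetaPart p s) (z : Fin 2 → Fq p f) : pointEval p f z v = 0 := by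
  have : thetaPart p s ≤ LinearMap.ker (pointEval p f z).toLinearMap := by
    refine iSup_le fun i w hw => ?_
    obtain ⟨u, rfl⟩ := Ideal.mem_span_singleton.1 hw.2
    simp [pointEval_theta]
  exact this hv

/-- Replacing `x_{i-1}^p y_i` by `y_{i-1}^p x_i` in a monomial. -/
theorem exists_monomial_sub_mem_thetaPart {s : Fin f → ℕ} {e : Fin f × Fin 2 →₀ ℕ}
    (he : Finsupp.weight (varWeight f) e = s) {i : Fin f} (h0 : p ≤ e (i - 1, 0))
    (h1 : e (i, 1) ≠ 0) :
    ∃ e' : Fin f × Fin 2 →₀ ℕ, Finsupp.weight (varWeight f) e' = s ∧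
      ∑ j, e' (j, 0) < ∑ j, e (j, 0) ∧
      (monomial e 1 - monomial e' 1 : PolyRing p f) ∈ thetaPart p s := by
  classical
  set d := Finsupp.single (i - 1, (0 : Fin 2)) p + Finsupp.single (i, (1 : Fin 2)) 1 with hd
  set d' := Finsupp.single (i - 1, (1 : Fin 2)) p + Finsupp.single (i, (0 : Fin 2)) 1 with hd'
  have hde : d ≤ e := by
    intro v
    simp only [hd, Finsupp.add_apply, Finsupp.single_apply]
    obtain ⟨j, l⟩ := v
    fin_cases l
    · by_cases hj : i - 1 = j
      · subst hj; simpa using h0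
      · simp [hj]
    · by_cases hj : i = j
      · subst hj; simpa using Nat.one_le_iff_ne_zero.2 h1
      · simp [hj]
  obtain ⟨u, rfl⟩ := exists_add_of_le hde
  have hw : Finsupp.weight (varWeight f) (d' + u) = s := by
    rw [← he]
    ext j
    simp only [weight_varWeight, hd, hd', Finsupp.add_apply, Finsupp.single_apply, Prod.mk.injEq]
    by_cases h : i - 1 = j <;> by_cases h' : i = j <;> simp [h, h'] <;> omega
  refine ⟨d' + u, hw, ?_, ?_⟩
  -- The move trades $p$ factors $x_{i-1}$ for one $x_i$, so the total $x$-degree drops by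
  -- $p-1\ge1$.
  · have hp := (Fact.out : p.Prime).two_le
    simp only [hd, hd', Finsupp.add_apply, Finset.sum_add_distrib, Finsupp.single_apply,
      Prod.mk.injEq]
    simp
    omega
  · refine mem_thetaPart p i (Submodule.sub_mem _
      (isWeightedHomogeneous_monomial _ _ _ he) (isWeightedHomogeneous_monomial _ _ _ hw))
      ⟨-monomial u 1, ?_⟩
    have key : ∀ (j l : Fin f × Fin 2),
        (monomial (Finsupp.single j p + Finsupp.single l 1 + u) 1 : PolyRing p f) =
          X j ^ p * X l * monomial u 1 := by
      intro j l
      rw [X_pow_eq_monomial, X, monomial_mul, monomial_mul]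
      simp
    rw [hd, hd', key, key, theta]
    ring

theorem forall_of_forall_add_one {P : Fin f → Prop} (h : ∀ i, P i → P (i + 1)) {i : Fin f}
    (hi : P i) (j : Fin f) : P j := by
  have key (n : ℕ) : P (i + Fin.ofNat f n) := by
    induction n with
    | zero => simpa [show Fin.ofNat f 0 = 0 from rfl] using hi
    | succ n ih =>
      have : Fin.ofNat f (n + 1) = Fin.ofNat f n + 1 := by ext; simp [Fin.val_add]
      rw [this, ← add_assoc]
      exact h _ ih
  have := key ((j - i : Fin f) : ℕ)
  rwa [Fin.ofNat_val_eq_self, add_sub_cancel] at this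

/-- The replacement move lowers the $x$-degree, so it terminates. In a terminal monomial,
$x_{i-1}$-exponent at least $p$ forces $y_i$-exponent $0$. If some $y_i$-exponent is $0$, then $x_i$
has exponent $s_i\ge p$, and this propagates around the cycle to give $\prod x_i^{s_i}$. Otherwise
all $x$-exponents are below $p$, i.e. are digits. -/
theorem monomial_mem_normalForms {s : Fin f → ℕ} (hs : ∀ i, p ≤ s i) (n : ℕ) :
    ∀ e : Fin f × Fin 2 →₀ ℕ, Finsupp.weight (varWeight f) e = s → ∑ j, e (j, 0) = n →
      (monomial e 1 : PolyRing p f) ∈ thetaPart p s ⊔ (Submodule.span _ {bihomMonomial p s s} ⊔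
        (Polynomial.degreeLT (Fq p f) (p ^ f)).map (digitPoly p s)) := by
  induction n using Nat.strong_induction_on with
  | _ n ih =>
  intro e he hn
  by_cases hmove : ∃ i, p ≤ e (i - 1, 0) ∧ e (i, 1) ≠ 0
  · obtain ⟨i, h0, h1⟩ := hmove
    obtain ⟨e', he', hlt, hmem⟩ := exists_monomial_sub_mem_thetaPart p he h0 h1
    rw [← sub_add_cancel (monomial e 1 : PolyRing p f) (monomial e' 1)]
    exact Submodule.add_mem _ (Submodule.mem_sup_left hmem) (ih _ (hn ▸ hlt) e' he' rfl)
  · push Not at hmove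
    refine Submodule.mem_sup_right ?_
    have hsum : ∀ i, e (i, 0) + e (i, 1) = s i := fun i => by rw [← weight_varWeight, he]
    rw [eq_bihomExponent he, ← bihomMonomial]
    by_cases hx : ∃ i, e (i, 1) = 0
    · obtain ⟨i, hi⟩ := hx
      have hall := forall_of_forall_add_one (P := fun i => e (i, 1) = 0) (fun j hj =>
        hmove (j + 1) (by
          rw [add_sub_cancel_right]
          have := hsum j
          have := hs j
          omega)) hi
      refine Submodule.mem_sup_left ?_
      have : (fun i => e (i, 0)) = s := by
        ext i
        have := hsum i
        have := hall i
        omega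
      rw [this]
      exact Submodule.mem_span_singleton_self _
    · push Not at hx
      have hlt : ∀ i, e (i, 0) < p := by
        intro i
        by_contra h
        refine hx (i + 1) (hmove (i + 1) ?_)
        rw [add_sub_cancel_right]
        omega
      refine Submodule.mem_sup_right ⟨_, ?_, digitPoly_X_pow p s fun i => ⟨e (i, 0), hlt i⟩⟩
      rw [SetLike.mem_coe, Polynomial.mem_degreeLT, Polynomial.degree_X_pow]
      exact_mod_cast (finFunctionFinEquiv _).isLt

theorem symPow_le_normalForms {s : Fin f → ℕ} (hs : ∀ i, p ≤ s i) :
    (symPow p f s).toSubmodule ≤ thetaPart p s ⊔ (Submodule.span _ {bihomMonomial p s s} ⊔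
        (Polynomial.degreeLT (Fq p f) (p ^ f)).map (digitPoly p s)) := by
  intro v hv
  refine IsWeightedHomogeneous.induction_on (motive := fun v _ => v ∈ _) (Submodule.zero_mem _)
    (fun _ _ _ _ h h' => Submodule.add_mem _ h h') (fun d c hd => ?_) hv
  have : (monomial d c : PolyRing p f) = c • monomial d 1 := by simp [smul_monomial]
  rw [this]
  exact Submodule.smul_mem _ _ (monomial_mem_normalForms p hs _ d hd rfl)

/-- An element of `V_s` which vanishes at the `𝔽_q`-points of the projective line is a sum of
multiples of the `θ_i`. -/
theorem mem_thetaPart_of_pointEval {s : Fin f → ℕ} (hs : ∀ i, p ≤ s i) {v : PolyRing p f}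
    (hv : v ∈ (symPow p f s).toSubmodule) (h0 : pointEval p f ![1, 0] v = 0)
    (h1 : ∀ t, pointEval p f ![t, 1] v = 0) : v ∈ thetaPart p s := by
  obtain ⟨w, hw, v', hv', rfl⟩ := Submodule.mem_sup.1 (symPow_le_normalForms p hs hv)
  obtain ⟨x, hx, _, ⟨Q, hQ, rfl⟩, rfl⟩ := Submodule.mem_sup.1 hv'
  obtain ⟨c, rfl⟩ := Submodule.mem_span_singleton.1 hx
  simp only [map_add, pointEval_eq_zero_of_mem_thetaPart p hw, zero_add, map_smul,
    pointEval_digitPoly_infty p hs, pointEval_bihomMonomial_self_infty, add_zero] at h0 h1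
  obtain rfl : c = 0 := by simpa using h0
  have : Fintype (Fq p f) := Fintype.ofFinite _
  -- $Q$ has degree below $q$ and vanishes at all $q$ elements of the field.
  have hQ0 : Q = 0 := by
    rcases eq_or_ne Q 0 with h | h
    · exact h
    refine Polynomial.eq_zero_of_natDegree_lt_card_of_eval_eq_zero Q Function.injective_id
      (fun t => ?_) ?_
    · simpa [pointEval_digitPoly p s hQ] using h1 t
    · rw [← Nat.card_eq_fintype_card, GaloisField.card p f (NeZero.ne f)]
      exact (Polynomial.natDegree_lt_iff_degree_lt h).2 (Polynomial.mem_degreeLT.1 hQ)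
  simpa [hQ0] using hw

theorem exists_pointEval_eq {s : Fin f → ℕ} (hs : ∀ i, p ≤ s i) (c : Fq p f)
    (φ : Fq p f → Fq p f) : ∃ v ∈ (symPow p f s).toSubmodule,
      pointEval p f ![1, 0] v = c ∧ ∀ t, pointEval p f ![t, 1] v = φ t := by
  classical
  have : Fintype (Fq p f) := Fintype.ofFinite _
  -- Only $\prod x_i^{s_i}$ among the normal forms is nonzero at infinity, so its coefficient must
  -- be `c`; the digit monomials then interpolate what remains at the finite points.
  set Q := Lagrange.interpolate Finset.univ id
    fun t => φ t - c * pointEval p f ![t, 1] (bihomMonomial p s s) with hQ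
  have hdeg : Q ∈ Polynomial.degreeLT (Fq p f) (p ^ f) := by
    rw [Polynomial.mem_degreeLT]
    refine (Lagrange.degree_interpolate_lt _ Function.injective_id.injOn).trans_eq ?_
    rw [Finset.card_univ, ← Nat.card_eq_fintype_card, GaloisField.card p f (NeZero.ne f)]
  refine ⟨c • bihomMonomial p s s + digitPoly p s Q, Submodule.add_mem _
    (Submodule.smul_mem _ _ (bihomMonomial_mem p fun _ => le_rfl)) (digitPoly_mem p hs Q), ?_, ?_⟩
  · simp [pointEval_digitPoly_infty p hs, pointEval_bihomMonomial_self_infty]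
  · intro t
    have := Lagrange.eval_interpolate_at_node (s := Finset.univ) (v := id)
      (fun t => φ t - c * pointEval p f ![t, 1] (bihomMonomial p s s))
      Function.injective_id.injOn (Finset.mem_univ t)
    rw [← hQ, id] at this
    simp [pointEval_digitPoly p s hdeg, this]

end NormalForms

/-! ### First-order expansion at $(0,1)$ and the coefficient functionals -/

noncomputable section ThetaCoefficients

variable (p f : ℕ) [Fact p.Prime]

/-- Expansion at the point `x_i = 0`, `y_i = 1`: the substitution `x_i ↦ ε_i`, `y_i ↦ 1`. -/
def localExpansion : PolyRing p f →ₐ[Fq p f] MvPolynomial (Fin f) (Fq p f) :=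
  aeval fun v => if v.2 = 0 then X v.1 else 1

theorem constantCoeff_localExpansion (P : PolyRing p f) :
    constantCoeff (localExpansion p f P) = pointEval p f ![0, 1] P := by
  have : (aeval fun _ => (0 : Fq p f)).comp (localExpansion p f) = pointEval p f ![0, 1] := by
    refine MvPolynomial.algHom_ext fun ⟨i, j⟩ => ?_
    have : (p ^ (i : ℕ)) ≠ 0 := pow_ne_zero _ (Fact.out : p.Prime).ne_zero
    fin_cases j <;> simp [localExpansion, pointEval, zero_pow this]
  rw [← this, AlgHom.comp_apply, constantCoeff_eq, aeval_zero']
  simp [constantCoeff_eq]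

variable {f} in
/-- The exponent of the squarefree monomial `∏_{i ∈ X} ε_i`. -/
def squarefreeExponent (X : Finset (Fin f)) : Fin f →₀ ℕ := ∑ i ∈ X, Finsupp.single i 1

variable {f} in
theorem squarefreeExponent_apply (X : Finset (Fin f)) (i : Fin f) :
    squarefreeExponent X i = if i ∈ X then 1 else 0 := by
  classical
  simp [squarefreeExponent, Finsupp.finsetSum_apply, Finsupp.single_apply]

variable {f} in
theorem squarefreeExponent_le_iff {X Y : Finset (Fin f)} :
    squarefreeExponent X ≤ squarefreeExponent Y ↔ X ⊆ Y := by
  constructor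
  · intro h i hi
    have := h i
    simp only [squarefreeExponent_apply, if_pos hi] at this
    by_contra hc
    simp [hc] at this
  · intro h i
    simp only [squarefreeExponent_apply]
    by_cases hi : i ∈ X
    · simp [hi, h hi]
    · simp [hi]

variable {f} in
theorem prod_X_eq_monomial (X : Finset (Fin f)) :
    (∏ i ∈ X, MvPolynomial.X i : MvPolynomial (Fin f) (Fq p f)) =
      monomial (squarefreeExponent X) 1 := by
  rw [squarefreeExponent, monomial_sum_one]
  rfl

/-- The ideal generated by the `ε_i^2`. -/
def squareIdeal : Ideal (MvPolynomial (Fin f) (Fq p f)) :=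
  Ideal.span ((fun d => monomial d 1) '' Set.range fun i => Finsupp.single i 2)

variable {f}

theorem coeff_eq_zero_of_mem_squareIdeal {P : MvPolynomial (Fin f) (Fq p f)}
    (hP : P ∈ squareIdeal p f) (X : Finset (Fin f)) : coeff (squarefreeExponent X) P = 0 := by
  by_contra h
  obtain ⟨_, ⟨i, rfl⟩, hi⟩ :=
    mem_ideal_span_monomial_image.1 hP _ (MvPolynomial.mem_support_iff.2 h)
  have := hi i
  rw [Finsupp.single_eq_same, squarefreeExponent_apply] at this
  split_ifs at this <;> omega

variable (f) in
theorem X_sq_mem_squareIdeal (i : Fin f) :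
    (X i ^ 2 : MvPolynomial (Fin f) (Fq p f)) ∈ squareIdeal p f := by
  rw [X_pow_eq_monomial]
  exact Ideal.subset_span ⟨_, ⟨i, rfl⟩, rfl⟩

/-- The coefficient of `∏_{i ∈ X} ε_i` in the expansion at `x_i = 0`, `y_i = 1`. -/
def thetaCoeff (X : Finset (Fin f)) : PolyRing p f →ₗ[Fq p f] Fq p f :=
  (lcoeff (Fq p f) (squarefreeExponent X)).comp (localExpansion p f).toLinearMap

theorem thetaCoeff_apply (X : Finset (Fin f)) (P : PolyRing p f) :
    thetaCoeff p X P = coeff (squarefreeExponent X) (localExpansion p f P) := rfl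

variable [NeZero f]

theorem localExpansion_theta (i : Fin f) :
    localExpansion p f (theta p f i) = X i - X (i - 1) ^ p := by
  simp [localExpansion, theta]

theorem mk_localExpansion_theta (i : Fin f) :
    Ideal.Quotient.mk (squareIdeal p f) (localExpansion p f (theta p f i)) =
      Ideal.Quotient.mk (squareIdeal p f) (X i) := by
  rw [localExpansion_theta, Ideal.Quotient.mk_eq_mk_iff_sub_mem, sub_sub_cancel_left, neg_mem_iff]
  exact Ideal.pow_mem_of_pow_mem _ (X_sq_mem_squareIdeal p f (i - 1)) (Fact.out : p.Prime).two_le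

theorem thetaCoeff_sq_mul (X : Finset (Fin f)) (i : Fin f) (h : PolyRing p f) :
    thetaCoeff p X (theta p f i ^ 2 * h) = 0 := by
  rw [thetaCoeff_apply]
  refine coeff_eq_zero_of_mem_squareIdeal p ?_ X
  rw [← Ideal.Quotient.eq_zero_iff_mem, map_mul, map_mul, map_pow, map_pow,
    mk_localExpansion_theta, ← map_pow, Ideal.Quotient.eq_zero_iff_mem.2, zero_mul]
  exact X_sq_mem_squareIdeal p f i

theorem thetaCoeff_thetaProd_mul_eq (X Z : Finset (Fin f)) (h : PolyRing p f) :
    thetaCoeff p X (thetaProd p f Z * h) =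
      coeff (squarefreeExponent X) (monomial (squarefreeExponent Z) 1 * localExpansion p f h) := by
  rw [thetaCoeff_apply, ← sub_eq_zero, ← coeff_sub]
  refine coeff_eq_zero_of_mem_squareIdeal p ?_ X
  rw [← Ideal.Quotient.mk_eq_mk_iff_sub_mem, ← prod_X_eq_monomial, thetaProd]
  simp only [map_mul, map_prod, mk_localExpansion_theta]

theorem thetaCoeff_thetaProd_mul {X Z : Finset (Fin f)} (hZ : ¬Z ⊆ X) (h : PolyRing p f) :
    thetaCoeff p X (thetaProd p f Z * h) = 0 := by
  rw [thetaCoeff_thetaProd_mul_eq, coeff_monomial_mul', if_neg]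
  rwa [squarefreeExponent_le_iff]

theorem thetaCoeff_thetaProd_mul_self (X : Finset (Fin f)) (h : PolyRing p f) :
    thetaCoeff p X (thetaProd p f X * h) = pointEval p f ![0, 1] h := by
  rw [thetaCoeff_thetaProd_mul_eq, coeff_monomial_mul', if_pos le_rfl, tsub_self, one_mul,
    ← constantCoeff_localExpansion, constantCoeff_eq]

theorem subst_thetaProd (g : GL (Fin 2) (Fq p f)) (X : Finset (Fin f)) :
    subst p f g (thetaProd p f X) =
      C (g.1.det ^ ∑ i ∈ X, p ^ (i : ℕ)) * thetaProd p f X := by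
  rw [thetaProd, map_prod, ← Finset.prod_pow_eq_pow_sum, map_prod, ← Finset.prod_mul_distrib]
  simp only [subst_theta, Matrix.det_fin_two]

/-- $P_X$ is an eigenvector with eigenvalue a power of $\det g$, and $(0,1)g$ is the bottom row of
$g$. -/
theorem thetaCoeff_subst (X : Finset (Fin f)) (g : GL (Fin 2) (Fq p f)) (h : PolyRing p f) :
    thetaCoeff p X (subst p f g (thetaProd p f X * h)) =
      g.1.det ^ (∑ i ∈ X, p ^ (i : ℕ)) * pointEval p f (g.1 1) h := by
  rw [map_mul, subst_thetaProd, mul_assoc, C_mul', map_smul, thetaCoeff_thetaProd_mul_self,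
    pointEval_subst, smul_eq_mul]
  congr 3
  ext j
  simp [Matrix.vecMul, dotProduct, Fin.sum_univ_two]

/-- The multidegree of `P_X`. -/
def thetaWeight (X : Finset (Fin f)) : Fin f → ℕ :=
  ∑ i ∈ X, (Pi.single i 1 + p • Pi.single (i - 1) 1)

omit [Fact p.Prime] in
-- Only $\theta_j$ (degree $1$) and $\theta_{j+1}$ (degree $p$) involve $x_j,y_j$.
theorem thetaWeight_le (X : Finset (Fin f)) (j : Fin f) : thetaWeight p X j ≤ p + 1 := by
  rw [thetaWeight, Finset.sum_apply]
  refine (Finset.sum_le_sum_of_subset (Finset.subset_univ X)).trans ?_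
  have (i : Fin f) : j = i - 1 ↔ j + 1 = i := eq_sub_iff_add_eq
  simp [Finset.sum_add_distrib, Pi.single_apply, this, add_comm]

theorem isWeightedHomogeneous_thetaProd (X : Finset (Fin f)) :
    IsWeightedHomogeneous (varWeight f) (thetaProd p f X) (thetaWeight p X) := by
  refine IsWeightedHomogeneous.prod _ _ _ fun i _ => ?_
  have key (l l' : Fin 2) : IsWeightedHomogeneous (varWeight f)
      (MvPolynomial.X (i, l) * MvPolynomial.X (i - 1, l') ^ p : PolyRing p f)
      (Pi.single i 1 + p • Pi.single (i - 1) 1) :=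
    (isWeightedHomogeneous_X _ (varWeight f) (i, l)).mul
      ((isWeightedHomogeneous_X _ (varWeight f) (i - 1, l')).pow p)
  exact (key 0 1).sub (key 1 0)

omit [NeZero f] in
attribute [local instance] MvPolynomial.weightedGradedAlgebra in
-- The cofactor may be replaced by its component of multidegree $s$, since the product with $P$ is
-- homogeneous.
theorem exists_eq_mul_of_dvd {P v : PolyRing p f} {m s : Fin f → ℕ}
    (hP : IsWeightedHomogeneous (varWeight f) P m) (hv : v ∈ (symPow p f (m + s)).toSubmodule)
    (h : P ∣ v) : ∃ u ∈ (symPow p f s).toSubmodule, v = P * u := by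
  classical
  obtain ⟨u, rfl⟩ := h
  refine ⟨weightedHomogeneousComponent (varWeight f) s u,
    weightedHomogeneousComponent_isWeightedHomogeneous _ _, ?_⟩
  have h1 := DirectSum.coe_decompose_mul_add_of_left_mem
    (weightedHomogeneousSubmodule (Fq p f) (varWeight f)) (j := s) (b := u) hP
  rw [DirectSum.decompose_of_mem_same (weightedHomogeneousSubmodule (Fq p f) (varWeight f)) hv]
    at h1
  rw [h1]
  congr 1
  exact weightedDecomposition.decompose'_apply (Fq p f) (varWeight f) u s

end ThetaCoefficients

/-! ### Recognising inductions from the Borel subgroup -/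

section PrincipalSeriesCriterion

variable {k : Type*} [Field k]

/-- A subquotient of `W` is a principal series if an equivariant map from `W` to the functions
on `GL₂(k)` restricts to a surjection from its top onto the induction of a character, with kernel
its bottom. -/
theorem Subquotient.isPrincipalSeries_rep {W : Type*} [AddCommGroup W] [Module k W]
    {ρ : Representation k (GL (Fin 2) k) W} (S : Subquotient ρ) (χ : borelSubgroup k →* kˣ)
    (Ψ : W →ₗ[k] (GL (Fin 2) k → k)) (hΨ : ∀ g w g', Ψ (ρ g w) g' = Ψ w (g' * g))
    (hmem : ∀ w ∈ S.top.toSubmodule,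
      Ψ w ∈ Representation.coindV (borelSubgroup k).subtype (charRep χ))
    (hsurj : ∀ φ ∈ Representation.coindV (borelSubgroup k).subtype (charRep χ),
      ∃ w ∈ S.top.toSubmodule, Ψ w = φ)
    (hker : ∀ w ∈ S.top.toSubmodule, Ψ w = 0 ↔ w ∈ S.bot.toSubmodule) :
    IsPrincipalSeries S.rep := by
  let Ψ' : S.top.toSubmodule →ₗ[k]
      Representation.coindV (borelSubgroup k).subtype (charRep χ) :=
    (Ψ.comp S.top.toSubmodule.subtype).codRestrict _ fun w => hmem w w.2
  have hΨ' : S.inner.toSubmodule = LinearMap.ker Ψ' := by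
    ext w
    rw [LinearMap.mem_ker, ← Subtype.coe_inj]
    exact (hker w w.2).symm
  let F : S.rep.IntertwiningMap
      (Representation.coind (borelSubgroup k).subtype (charRep χ)) :=
    { toLinearMap := S.inner.toSubmodule.liftQ Ψ' hΨ'.le
      isIntertwining' := fun g => by
        refine LinearMap.ext fun w => ?_
        induction w using Submodule.Quotient.induction_on with
        | _ w => exact Subtype.ext (funext fun g' => hΨ g w g') }
  refine ⟨χ, ⟨F.ofBijective ⟨?_, ?_⟩⟩⟩
  · change Function.Injective (S.inner.toSubmodule.liftQ Ψ' hΨ'.le)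
    rw [← LinearMap.ker_eq_bot]
    exact Submodule.ker_liftQ_eq_bot' _ _ hΨ'
  · rintro ⟨φ, hφ⟩
    obtain ⟨w, hw, h⟩ := hsurj φ hφ
    exact ⟨Submodule.Quotient.mk ⟨w, hw⟩, Subtype.ext h⟩

/-- The matrix `(1, 0; t, 1)`. -/
def lowerUnipotent (t : k) : GL (Fin 2) k :=
  GeneralLinearGroup.mkOfDetNeZero !![1, 0; t, 1] (by simp)

variable (k) in
/-- The matrix `(0, -1; 1, 0)`. -/
def weylElement : GL (Fin 2) k :=
  GeneralLinearGroup.mkOfDetNeZero !![0, -1; 1, 0] (by simp)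

/-- The coset $Bg$ is determined by the bottom row up to scaling, a point of $\mathbb P^1(k)$; the
representatives have bottom rows $(1,0)$ and $(t,1)$. -/
theorem exists_borel_mul (g : GL (Fin 2) k) :
    ∃ b : borelSubgroup k, g = b.1 * weylElement k ∨ ∃ t, g = b.1 * lowerUnipotent t := by
  by_cases h : g 1 1 = 0
  · refine ⟨⟨g * (weylElement k)⁻¹, ?_⟩, Or.inl (by simp)⟩
    change (g * (weylElement k)⁻¹) 1 0 = 0
    simp [weylElement, Matrix.mul_apply, Fin.sum_univ_two, Matrix.inv_def,
      Matrix.adjugate_fin_two, h, GeneralLinearGroup.mkOfDetNeZero]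
  · refine ⟨⟨g * (lowerUnipotent (g 1 0 / g 1 1))⁻¹, ?_⟩, Or.inr ⟨g 1 0 / g 1 1, by simp⟩⟩
    change (g * (lowerUnipotent (g 1 0 / g 1 1))⁻¹) 1 0 = 0
    simp [lowerUnipotent, Matrix.mul_apply, Fin.sum_univ_two, Matrix.inv_def,
      Matrix.adjugate_fin_two, GeneralLinearGroup.mkOfDetNeZero]
    field_simp
    ring

theorem eq_of_mem_coindV {χ : borelSubgroup k →* kˣ} {φ φ' : GL (Fin 2) k → k}
    (h : φ ∈ Representation.coindV (borelSubgroup k).subtype (charRep χ))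
    (h' : φ' ∈ Representation.coindV (borelSubgroup k).subtype (charRep χ))
    (hw : φ (weylElement k) = φ' (weylElement k))
    (ht : ∀ t, φ (lowerUnipotent t) = φ' (lowerUnipotent t)) : φ = φ' := by
  ext g
  obtain ⟨b, rfl | ⟨t, rfl⟩⟩ := exists_borel_mul g
  · rw [← Subgroup.subtype_apply, h, h', hw]
  · rw [← Subgroup.subtype_apply, h, h', ht]

/-- The character `b ↦ b_{11}^m det(b)^n` of the Borel subgroup. -/
def borelCharacter (m n : ℕ) : borelSubgroup k →* kˣ :=
  MonoidHom.toHomUnits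
    { toFun := fun b => b.1 1 1 ^ m * b.1.1.det ^ n
      map_one' := by simp
      map_mul' := fun b b' => by
        have hb : b.1 1 0 = 0 := b.2
        simp [Matrix.mul_apply, Fin.sum_univ_two, hb, mul_pow]
        ring }

theorem mem_coindV_borelCharacter {m n : ℕ} {φ : GL (Fin 2) k → k} :
    φ ∈ Representation.coindV (borelSubgroup k).subtype (charRep (borelCharacter m n)) ↔
      ∀ (b : borelSubgroup k) (g : GL (Fin 2) k),
        φ (b * g) = b.1 1 1 ^ m * b.1.1.det ^ n * φ g :=
  Iff.rfl

end PrincipalSeriesCriterion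

/-! ### The equivariant maps from $V_r$ to functions on $\mathrm{GL}_2(\mathbb F_q)$ -/

noncomputable section VertexRepresentations

variable (p : ℕ) {f : ℕ} [Fact p.Prime]

theorem pointEval_smul {s : Fin f → ℕ} {u : PolyRing p f} (hu : u ∈ (symPow p f s).toSubmodule)
    (c : Fq p f) (z : Fin 2 → Fq p f) :
    pointEval p f (c • z) u = c ^ (∑ i : Fin f, s i * p ^ (i : ℕ)) * pointEval p f z u := by
  refine IsWeightedHomogeneous.induction_on (w := varWeight f) (m := s) (motive := fun u _ =>
    pointEval p f (c • z) u = c ^ (∑ i : Fin f, s i * p ^ (i : ℕ)) * pointEval p f z u)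
    (by simp) (fun u v _ _ h h' => by rw [map_add, h, h', map_add, mul_add]) (fun d a hd => ?_) hu
  have hle (i : Fin f) : d (i, 0) ≤ s i := by
    rw [← hd, weight_varWeight]
    exact Nat.le_add_right _ _
  rw [← mul_one a, ← smul_eq_mul, ← smul_monomial, eq_bihomExponent hd, ← bihomMonomial,
    map_smul, map_smul, pointEval_bihomMonomial, pointEval_bihomMonomial,
    ← Finset.prod_pow_eq_pow_sum, smul_eq_mul, smul_eq_mul,
    mul_left_comm (∏ i : Fin f, c ^ (s i * p ^ (i : ℕ)))]
  congr 1
  simp only [← Finset.prod_mul_distrib]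
  refine Finset.prod_congr rfl fun i _ => ?_
  have h : c ^ (s i * p ^ (i : ℕ)) =
      (c ^ p ^ (i : ℕ)) ^ d (i, 0) * (c ^ p ^ (i : ℕ)) ^ (s i - d (i, 0)) := by
    rw [← pow_add, Nat.add_sub_cancel' (hle i), ← pow_mul, mul_comm]
  rw [h]
  simp only [Pi.smul_apply, smul_eq_mul, mul_pow]
  ring

variable (r : Fin f → ℕ)

/-- The function on `GL₂(𝔽_q)` attached to an element of `V_r` and to `X`. -/
def thetaMap (X : Finset (Fin f)) :
    (symPow p f r).toSubmodule →ₗ[Fq p f] (GL (Fin 2) (Fq p f) → Fq p f) :=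
  LinearMap.pi fun g => (thetaCoeff p X).comp
    ((polyRep p f g).comp (symPow p f r).toSubmodule.subtype)

theorem thetaMap_apply (X : Finset (Fin f)) (v : (symPow p f r).toSubmodule)
    (g : GL (Fin 2) (Fq p f)) : thetaMap p r X v g = thetaCoeff p X (subst p f g v) := rfl

theorem thetaMap_symRep (X : Finset (Fin f)) (g g' : GL (Fin 2) (Fq p f))
    (v : (symPow p f r).toSubmodule) :
    thetaMap p r X (symRep p f r g v) g' = thetaMap p r X v (g' * g) := by
  rw [thetaMap_apply, thetaMap_apply, subst_mul]
  rfl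

/-- The kernel of `thetaMap`. -/
def thetaKernel (X : Finset (Fin f)) : Subrepresentation (symRep p f r) where
  toSubmodule := LinearMap.ker (thetaMap p r X)
  apply_mem_toSubmodule g v hv := by
    rw [LinearMap.mem_ker] at hv ⊢
    ext g'
    rw [thetaMap_symRep, hv]
    rfl

theorem multiples_le_thetaKernel {X : Finset (Fin f)} {P : PolyRing p f} (hP : DvdStable p f P)
    (h : ∀ u, thetaCoeff p X (P * u) = 0) : multiples p f r P hP ≤ thetaKernel p r X := by
  intro v hv
  refine LinearMap.mem_ker.2 (funext fun g => ?_)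
  obtain ⟨u, hu⟩ := (hP g).trans (map_dvd (subst p f g) hv)
  rw [thetaMap_apply, hu, h]
  rfl

variable [NeZero f]

theorem symPowStarStar_le_thetaKernel (X : Finset (Fin f)) :
    symPowStarStar p f r ≤ thetaKernel p r X :=
  Finset.sup_le fun i _ => multiples_le_thetaKernel p r _ (thetaCoeff_sq_mul p X i)

theorem thetaMultiples_le_thetaKernel {X Z : Finset (Fin f)} (h : ¬Z ⊆ X) :
    thetaMultiples p f r Z ≤ thetaKernel p r X :=
  multiples_le_thetaKernel p r _ (thetaCoeff_thetaProd_mul p h)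

theorem thetaSpan_le_thetaKernel {X : Finset (Fin f)} {S : Finset (Finset (Fin f))}
    (h : ∀ Z ∈ S, ¬Z ⊆ X) : thetaSpan p f r S ≤ thetaKernel p r X :=
  Finset.sup_le fun Z hZ => thetaMultiples_le_thetaKernel p r (h Z hZ)

theorem not_subset_of_mem_covers {f : ℕ} {X Y : Finset (Fin f)} (h : Y ∈ covers X) : ¬Y ⊆ X :=
  (Finset.mem_filter.mp h).2.1.not_subset

/-- `thetaMap` on the quotient `V_r / V_r^{**}`. -/
def thetaQuotMap (X : Finset (Fin f)) :
    (symPow p f r).toSubmodule ⧸ (symPowStarStar p f r).toSubmodule →ₗ[Fq p f]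
      (GL (Fin 2) (Fq p f) → Fq p f) :=
  (symPowStarStar p f r).toSubmodule.liftQ (thetaMap p r X) (symPowStarStar_le_thetaKernel p r X)

theorem thetaQuotMap_bracket {X : Finset (Fin f)} {V : Subrepresentation (symRep p f r)}
    (h : V ≤ thetaKernel p r X) {w} (hw : w ∈ ((symPowStarStar p f r).bracket V).toSubmodule) :
    thetaQuotMap p r X w = 0 := by
  obtain ⟨v, hv, rfl⟩ := hw
  exact h hv

variable {r}

omit [Fact p.Prime] in
-- The lower bound on $r$ enters here: dividing by $P_X$ costs at most $p+1$ in each degree and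
-- leaves at least $p$, as the normal forms require.
theorem exists_eq_thetaWeight_add (hr : ∀ i, 2 * p ^ f + 1 ≤ r i) (X : Finset (Fin f)) :
    ∃ s : Fin f → ℕ, r = thetaWeight p X + s ∧ ∀ i, p ≤ s i := by
  have hle (i : Fin f) : thetaWeight p X i + p ≤ r i := by
    have h1 := thetaWeight_le p X i
    have h2 := hr i
    have h3 : p ≤ p ^ f := Nat.le_self_pow (NeZero.ne f) p
    omega
  refine ⟨r - thetaWeight p X, funext fun i => ?_, fun i => ?_⟩ <;>
  · have := hle i
    simp only [Pi.add_apply, Pi.sub_apply]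
    omega

end VertexRepresentations

/-! ### Image and kernel on $\langle P_X\rangle$: $V_X$ is a principal series -/

noncomputable section VertexPrincipalSeries

variable (p : ℕ) {f : ℕ} [Fact p.Prime] [NeZero f] {r : Fin f → ℕ}

theorem thetaMap_eq_det_pow_mul {X : Finset (Fin f)} {v : (symPow p f r).toSubmodule}
    {u : PolyRing p f} (h : (v : PolyRing p f) = thetaProd p f X * u)
    (g : GL (Fin 2) (Fq p f)) :
    thetaMap p r X v g = g.1.det ^ (∑ i ∈ X, p ^ (i : ℕ)) * pointEval p f (g.1 1) u := by
  rw [thetaMap_apply, h, thetaCoeff_subst]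

theorem thetaMap_weylElement {X : Finset (Fin f)} {v : (symPow p f r).toSubmodule}
    {u : PolyRing p f} (h : (v : PolyRing p f) = thetaProd p f X * u) :
    thetaMap p r X v (weylElement _) = pointEval p f ![1, 0] u := by
  rw [thetaMap_eq_det_pow_mul p h]
  simp [weylElement, GeneralLinearGroup.mkOfDetNeZero]
  rfl

theorem thetaMap_lowerUnipotent {X : Finset (Fin f)} {v : (symPow p f r).toSubmodule}
    {u : PolyRing p f} (h : (v : PolyRing p f) = thetaProd p f X * u) (t : Fq p f) :
    thetaMap p r X v (lowerUnipotent t) = pointEval p f ![t, 1] u := by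
  rw [thetaMap_eq_det_pow_mul p h]
  simp [lowerUnipotent, GeneralLinearGroup.mkOfDetNeZero]
  rfl

theorem exists_thetaMap_eq (hr : ∀ i, 2 * p ^ f + 1 ≤ r i) (X : Finset (Fin f)) (c : Fq p f)
    (φ : Fq p f → Fq p f) : ∃ v ∈ (thetaMultiples p f r X).toSubmodule,
      thetaMap p r X v (weylElement _) = c ∧ ∀ t, thetaMap p r X v (lowerUnipotent t) = φ t := by
  obtain ⟨s, rfl, hs⟩ := exists_eq_thetaWeight_add p hr X
  obtain ⟨u, hu, hc, hφ⟩ := exists_pointEval_eq p hs c φ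
  refine ⟨⟨thetaProd p f X * u, (isWeightedHomogeneous_thetaProd p X).mul hu⟩,
    Dvd.intro u rfl, ?_, fun t => ?_⟩
  · rw [thetaMap_weylElement p rfl, hc]
  · rw [thetaMap_lowerUnipotent p rfl, hφ]

theorem thetaMap_mem_coindV {s : Fin f → ℕ} {X : Finset (Fin f)} (hr : r = thetaWeight p X + s)
    {v : (symPow p f r).toSubmodule} (hv : v ∈ (thetaMultiples p f r X).toSubmodule) :
    thetaMap p r X v ∈ Representation.coindV (borelSubgroup (Fq p f)).subtype
      (charRep (borelCharacter (∑ i : Fin f, s i * p ^ (i : ℕ)) (∑ i ∈ X, p ^ (i : ℕ)))) := by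
  subst hr
  obtain ⟨u, hu, h⟩ := exists_eq_mul_of_dvd p (isWeightedHomogeneous_thetaProd p X) v.2 hv
  rw [mem_coindV_borelCharacter]
  intro b g
  -- Left multiplication by $B$ only rescales the bottom row, so homogeneity of `u` produces the
  -- character.
  have hrow : (b.1 * g).1 1 = b.1 1 1 • g.1 1 := by
    have hb : b.1.1 1 0 = 0 := b.2
    ext j
    simp [Matrix.mul_apply, Fin.sum_univ_two, hb]
  rw [thetaMap_eq_det_pow_mul p h, thetaMap_eq_det_pow_mul p h, hrow, pointEval_smul p hu,
    Units.val_mul, det_mul, mul_pow]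
  ring

/-- $\theta_iP_X$ is divisible by $\theta_i^2$ if $i\in X$, and equals $P_{X\cup\{i\}}$ with
$X\cup\{i\}$ covering $X$ if $i\notin X$. -/
theorem thetaProd_mul_mem {s : Fin f → ℕ} {X : Finset (Fin f)} (hr : r = thetaWeight p X + s)
    {u : PolyRing p f} (hu : u ∈ thetaPart p s) :
    thetaProd p f X * u ∈ (thetaSpan p f r (covers X) ⊔ symPowStarStar p f r).toSubmodule.map
      (symPow p f r).toSubmodule.subtype := by
  classical
  subst hr
  suffices h : thetaPart p s ≤ ((thetaSpan p f (thetaWeight p X + s) (covers X) ⊔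
      symPowStarStar p f (thetaWeight p X + s)).toSubmodule.map
        (symPow p f (thetaWeight p X + s)).toSubmodule.subtype).comap
      (LinearMap.mulLeft (Fq p f) (thetaProd p f X)) from h hu
  refine iSup_le fun i w hw => ?_
  have hdvd := mul_dvd_mul_left (thetaProd p f X) (Ideal.mem_span_singleton.1 hw.2)
  refine ⟨⟨thetaProd p f X * w, (isWeightedHomogeneous_thetaProd p X).mul hw.1⟩, ?_, rfl⟩
  by_cases hi : i ∈ X
  · refine (le_sup_right : symPowStarStar p f _ ≤ _) ?_
    refine (Finset.le_sup (f := fun i => multiples p f _ (theta p f i ^ 2)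
      (dvdStable_theta_pow p f i 2)) (Finset.mem_univ i)) ?_
    refine dvd_trans ?_ hdvd
    rw [sq]
    exact mul_dvd_mul_right (Finset.dvd_prod_of_mem _ hi) _
  · refine (le_sup_left : thetaSpan p f _ _ ≤ _) ?_
    have hcov : insert i X ∈ covers X :=
      Finset.mem_filter.2 ⟨Finset.mem_univ _, Finset.ssubset_insert hi,
        Finset.card_insert_of_notMem hi⟩
    refine (Finset.le_sup (f := thetaMultiples p f _) hcov) ?_
    change thetaProd p f (insert i X) ∣ _
    rwa [thetaProd, Finset.prod_insert hi, mul_comm]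

theorem mem_sup_of_mem_thetaKernel (hr : ∀ i, 2 * p ^ f + 1 ≤ r i) {X : Finset (Fin f)}
    {v : (symPow p f r).toSubmodule} (hv : v ∈ (thetaMultiples p f r X).toSubmodule)
    (h : thetaMap p r X v = 0) :
    v ∈ (thetaSpan p f r (covers X) ⊔ symPowStarStar p f r).toSubmodule := by
  obtain ⟨s, hrs, hs⟩ := exists_eq_thetaWeight_add p hr X
  obtain ⟨u, hu, huv⟩ := exists_eq_mul_of_dvd p (s := s) (isWeightedHomogeneous_thetaProd p X)
    (by rw [← hrs]; exact v.2) hv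
  have hmem := thetaProd_mul_mem p hrs (mem_thetaPart_of_pointEval p hs hu
    (by rw [← thetaMap_weylElement p huv, h]; rfl)
    fun t => by rw [← thetaMap_lowerUnipotent p huv, h]; rfl)
  rw [← huv] at hmem
  obtain ⟨v', hv', hvv⟩ := hmem
  rwa [← Subtype.ext hvv]

theorem mem_vertexRep_bot (hr : ∀ i, 2 * p ^ f + 1 ≤ r i) {X : Finset (Fin f)}
    {w} (hw : w ∈ (vertexRep p f r X).top.toSubmodule) (h : thetaQuotMap p r X w = 0) :
    w ∈ (vertexRep p f r X).bot.toSubmodule := by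
  obtain ⟨v, hv, rfl⟩ := hw
  obtain ⟨a, ha, b, hb, rfl⟩ := Submodule.mem_sup.1 (mem_sup_of_mem_thetaKernel p hr hv h)
  refine ⟨a, ha, ?_⟩
  refine (Submodule.Quotient.eq _).2 ?_
  rw [sub_add_cancel_left]
  exact neg_mem hb

theorem thetaQuotMap_of_mem_vertexRep_bot {X : Finset (Fin f)}
    {w} (hw : w ∈ (vertexRep p f r X).bot.toSubmodule) : thetaQuotMap p r X w = 0 :=
  thetaQuotMap_bracket p r
    (thetaSpan_le_thetaKernel p r fun _ hZ => not_subset_of_mem_covers hZ) hw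

theorem exists_thetaQuotMap_ne_zero (hr : ∀ i, 2 * p ^ f + 1 ≤ r i) (X : Finset (Fin f)) :
    ∃ w ∈ (vertexRep p f r X).top.toSubmodule, thetaQuotMap p r X w ≠ 0 := by
  obtain ⟨v, hv, h1, -⟩ := exists_thetaMap_eq p hr X 1 0
  refine ⟨_, ⟨v, hv, rfl⟩, fun h => one_ne_zero (α := Fq p f) ?_⟩
  rw [← h1]
  exact congrFun h (weylElement _)

theorem isPrincipalSeries_vertexRep (hr : ∀ i, 2 * p ^ f + 1 ≤ r i) (X : Finset (Fin f)) :
    IsPrincipalSeries (vertexRep p f r X).rep := by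
  obtain ⟨s, hrs, -⟩ := exists_eq_thetaWeight_add p hr X
  refine Subquotient.isPrincipalSeries_rep _
    (borelCharacter (∑ i : Fin f, s i * p ^ (i : ℕ)) (∑ i ∈ X, p ^ (i : ℕ)))
    (thetaQuotMap p r X) ?_ ?_ ?_ ?_
  · intro g w g'
    induction w using Submodule.Quotient.induction_on with
    | _ v => exact thetaMap_symRep p r X g g' v
  · rintro _ ⟨v, hv, rfl⟩
    exact thetaMap_mem_coindV p hrs hv
  · intro φ hφ
    obtain ⟨v, hv, hw, ht⟩ := exists_thetaMap_eq p hr X (φ (weylElement _))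
      fun t => φ (lowerUnipotent t)
    exact ⟨_, ⟨v, hv, rfl⟩, eq_of_mem_coindV (thetaMap_mem_coindV p hrs hv) hφ hw ht⟩
  · exact fun w hw => ⟨mem_vertexRep_bot p hr hw, thetaQuotMap_of_mem_vertexRep_bot p⟩

end VertexPrincipalSeries

/-! ### Extensions between the $V_X$ and the hypercube -/

section NaturalExtensions

namespace Subquotient

variable {k G W : Type*} [Field k] [Group G] [AddCommGroup W] [Module k W]
  {ρ : Representation k G W}

theorem natMap_mk_eq_zero_iff {S T : Subquotient ρ} (ht : S.top ≤ T.top) (hb : S.bot ≤ T.bot)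
    (w : S.top.toSubmodule) :
    S.natMap T ht hb (Submodule.Quotient.mk w) = 0 ↔ (w : W) ∈ T.bot.toSubmodule :=
  Submodule.Quotient.mk_eq_zero (x := Submodule.inclusion
    (show S.top.toSubmodule ≤ T.top.toSubmodule from ht) w) T.inner.toSubmodule

/-- The second isomorphism theorem: the kernel of $E\to U$ is $(V.top+E.bot)/E.bot$, the image of
$V$. -/
theorem isNaturalExtension_of_sup_eq {V E U : Subquotient ρ} (ht : V.top ≤ E.top)
    (hb : V.bot ≤ E.bot) (htop : E.top = U.top) (hinj : V.top ⊓ E.bot ≤ V.bot)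
    (hsup : V.top ⊔ E.bot = U.bot) : IsNaturalExtension V E U := by
  have hbot : E.bot ≤ U.bot := hsup ▸ le_sup_right
  refine ⟨ht, hb, htop.le, hbot, ?_, ?_, ?_⟩
  · refine (injective_iff_map_eq_zero (V.natMap E ht hb)).2 fun x hx => ?_
    induction x using Submodule.Quotient.induction_on with
    | _ w =>
      rw [natMap_mk_eq_zero_iff] at hx
      exact (Submodule.Quotient.mk_eq_zero V.inner.toSubmodule).2 (hinj ⟨w.2, hx⟩)
  · intro x
    induction x using Submodule.Quotient.induction_on with
    | _ w =>
      rw [natMap_mk_eq_zero_iff]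
      constructor
      · intro h
        rw [← hsup] at h
        obtain ⟨a, ha, b, hb', hab⟩ := Submodule.mem_sup.1 h
        refine ⟨Submodule.Quotient.mk ⟨a, ha⟩, (Submodule.Quotient.eq E.inner.toSubmodule).2 ?_⟩
        change a - (w : W) ∈ E.bot.toSubmodule
        rw [← hab, sub_add_cancel_left]
        exact neg_mem hb'
      · rintro ⟨y, hy⟩
        induction y using Submodule.Quotient.induction_on with
        | _ a =>
          have h : (a : W) - w ∈ E.bot.toSubmodule := (Submodule.Quotient.eq E.inner.toSubmodule).1 hy
          have ha : (a : W) ∈ U.bot.toSubmodule :=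
            (hsup ▸ le_sup_left : V.top ≤ U.bot) a.2
          rw [← sub_sub_cancel (a : W) w]
          exact sub_mem ha (hbot h)
  · intro x
    induction x using Submodule.Quotient.induction_on with
    | _ w => exact ⟨Submodule.Quotient.mk ⟨w, htop.ge w.2⟩, rfl⟩

/-- If `U.bot ≤ E.bot`, so that `E → U` is injective, then the sub `V` of the extension is zero. -/
theorem IsNaturalExtension.top_le_bot {V E U : Subquotient ρ} (h : IsNaturalExtension V E U)
    (hUE : U.bot ≤ E.bot) : V.top ≤ V.bot := by
  obtain ⟨ht₁, hb₁, ht₂, hb₂, hinj, hex, -⟩ := h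
  intro w hw
  have h0 : V.natMap E ht₁ hb₁ (Submodule.Quotient.mk ⟨w, hw⟩) = 0 := by
    rw [natMap_mk_eq_zero_iff]
    refine hUE ?_
    have := (hex _).2 ⟨Submodule.Quotient.mk ⟨w, hw⟩, rfl⟩
    exact (natMap_mk_eq_zero_iff ht₂ hb₂ ⟨w, ht₁ hw⟩).1 this
  exact (Submodule.Quotient.mk_eq_zero V.inner.toSubmodule (x := ⟨w, hw⟩)).1
    ((injective_iff_map_eq_zero (V.natMap E ht₁ hb₁)).1 hinj _ h0)

end Subquotient

theorem Subrepresentation.bracket_sup {k G W : Type*} [Field k] [Group G] [AddCommGroup W]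
    [Module k W] {ρ : Representation k G W} (N V V' : Subrepresentation ρ) :
    N.bracket (V ⊔ V') = N.bracket V ⊔ N.bracket V' :=
  Subrepresentation.toSubmodule_injective (Submodule.map_sup _ _ N.toSubmodule.mkQ)

variable (p : ℕ) {f : ℕ} [Fact p.Prime] [NeZero f] {r : Fin f → ℕ}

/-- Injectivity of $V_Y\to E_{X,Y}$ is the main point: no index $Z$ in the bottom of $E_{X,Y}$ lies
in $Y$, so `thetaMap` for $Y$ kills that bottom, while its kernel on the top of $V_Y$ is the bottom
of $V_Y$. -/
theorem isNaturalExtension_extRep (hr : ∀ i, 2 * p ^ f + 1 ≤ r i) {X Y : Finset (Fin f)}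
    (h : X ⊆ Y) (hc : Y.card = X.card + 1) :
    (vertexRep p f r Y).IsNaturalExtension (extRep p f r X Y h) (vertexRep p f r X) := by
  have hY : Y ∈ covers X := Finset.mem_filter.2
    ⟨Finset.mem_univ _, Finset.ssubset_iff_subset_ne.2 ⟨h, fun e => by simp [e] at hc⟩, hc⟩
  refine Subquotient.isNaturalExtension_of_sup_eq
    (Subrepresentation.bracket_mono _ fun v hv =>
      (Finset.prod_dvd_prod_of_subset X Y (theta p f) h).trans hv)
    (Subrepresentation.bracket_mono _ (Finset.sup_mono Finset.subset_union_right)) rfl ?_ ?_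
  · rintro w ⟨hw, hw'⟩
    refine mem_vertexRep_bot p hr hw
      (thetaQuotMap_bracket p r (thetaSpan_le_thetaKernel p r fun Z hZ => ?_) hw')
    rcases Finset.mem_union.1 hZ with hZ | hZ
    · obtain ⟨hne, hZ⟩ := Finset.mem_erase.1 hZ
      intro hle
      have := (Finset.mem_filter.1 hZ).2.2
      exact hne (Finset.eq_of_subset_of_card_le hle (by omega))
    · exact not_subset_of_mem_covers hZ
  · refine (Subrepresentation.bracket_sup _ _ _).symm.trans (congrArg _ ?_)
    -- Adding $\langle P_Y\rangle$ restores the erased cover and absorbs all covers of $Y$.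
    rw [thetaSpan, Finset.sup_union, ← sup_assoc, ← Finset.sup_insert, Finset.insert_erase hY]
    refine sup_eq_left.2 ((thetaSpan_le p f r fun Z hZ => subset_of_mem_covers hZ).trans ?_)
    exact Finset.le_sup hY

/-- If $Y$ does not cover $X$, erasing it changes nothing, so the bottom of $E_{X,Y}$ contains that
of $V_X$. Exactness then forces $V_Y=0$, which is false. -/
theorem mem_covers_of_isNaturalExtension (hr : ∀ i, 2 * p ^ f + 1 ≤ r i) {X Y : Finset (Fin f)}
    (h : X ⊆ Y)
    (he : (vertexRep p f r Y).IsNaturalExtension (extRep p f r X Y h) (vertexRep p f r X)) :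
    Y ∈ covers X := by
  by_contra hY
  obtain ⟨w, hw, hne⟩ := exists_thetaQuotMap_ne_zero p hr Y
  refine hne (thetaQuotMap_of_mem_vertexRep_bot p (he.top_le_bot ?_ hw))
  refine Subrepresentation.bracket_mono _ (Finset.sup_mono ?_)
  rw [Finset.erase_eq_of_notMem hY]
  exact Finset.subset_union_left

/-- The tops alone distinguish the vertices: the map for $X$ is nonzero on $[\langle P_X\rangle]$
but kills $[\langle P_Y\rangle]$ when $Y\not\subseteq X$. -/
theorem subset_of_vertexRep_eq (hr : ∀ i, 2 * p ^ f + 1 ≤ r i) {X Y : Finset (Fin f)}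
    (h : vertexRep p f r X = vertexRep p f r Y) : Y ⊆ X := by
  by_contra hYX
  obtain ⟨w, hw, hne⟩ := exists_thetaQuotMap_ne_zero p hr X
  rw [h] at hw
  exact hne (thetaQuotMap_bracket p r (thetaMultiples_le_thetaKernel p r hYX) hw)

theorem vertexRep_injective (hr : ∀ i, 2 * p ^ f + 1 ≤ r i) :
    Function.Injective (vertexRep p f r) := fun _ _ h =>
  (subset_of_vertexRep_eq p hr h.symm).antisymm (subset_of_vertexRep_eq p hr h)

end NaturalExtensions

theorem mainTheorem8 (p f : ℕ) [Fact p.Prime] [NeZero f] (r : Fin f → ℕ)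
    (hr : ∀ i, 2 * p ^ f + 1 ≤ r i) :
    (∀ X : Finset (Fin f), IsPrincipalSeries (vertexRep p f r X).rep) ∧
    (∀ (X Y : Finset (Fin f)) (h : X ⊆ Y), Y.card = X.card + 1 →
      (vertexRep p f r Y).IsNaturalExtension (extRep p f r X Y h) (vertexRep p f r X)) ∧
    ∃ φ : (directedHypercube f).Adj ≃r (extensionGraph p f r).Adj,
      ∀ X : Finset (Fin f), (φ X : Subquotient (quotStarStar p f r)) = vertexRep p f r X := by
  refine ⟨isPrincipalSeries_vertexRep p hr, fun X Y h hc => isNaturalExtension_extRep p hr h hc,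
    ⟨Equiv.ofInjective _ (vertexRep_injective p hr), ?_⟩, fun X => rfl⟩
  intro X Y
  constructor
  · rintro ⟨X', Y', h, hX, hY, he⟩
    obtain rfl := vertexRep_injective p hr hX
    obtain rfl := vertexRep_injective p hr hY
    exact (Finset.mem_filter.1 (mem_covers_of_isNaturalExtension p hr h he)).2
  · rintro ⟨h, hc⟩
    exact ⟨X, Y, h.subset, rfl, rfl, isNaturalExtension_extRep p hr h.subset hc⟩
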